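/- Rings are associative with identity. Let $\mathcal{G}$ be a finite connected groupoid with object set $\mathcal{G}_0$, source and target maps $s,t$, each object being identified with its identity morphism. A partial action $\alpha=(A_g,\alpha_g)_{g\in\mathcal{G}}$ of $\mathcal{G}$ on a ring $A$ consists of ideals $A_{t(g)}$ of $A$, ideals $A_g$ of $A_{t(g)}$ and ring isomorphisms $\alpha_g:A_{g^{-1}}\to A_g$ such that $\alpha_z=\mathrm{id}_{A_z}$ for $z\in\mathcal{G}_0$ and, whenever $s(g)=t(h)$, $\alpha_h^{-1}(A_{g^{-1}}\cap A_h)\subseteq A_{(gh)^{-1}}$ and $\alpha_{gh}=\alpha_g\alpha_h$ on $\alpha_h^{-1}(A_{g^{-1}}\cap A_h)$. Suppose that $\alpha$ is unital, i.e. $A_g=A1_g$ with $1_g$ a central idempotent of $A$ for every $g$, that $A=\bigoplus_{z\in\mathcal{G}_0}A_z$, and that $\alpha$ is group-type: there are $x\in\mathcal{G}_0$ and morphisms $\tau_y:x\to y$ $(y\in\mathcal{G}_0)$ with $\tau_x=\mathrm{id}_x$, $A_{\tau_y^{-1}}=A_x$ and $A_{\tau_y}=A_y$ for all $y$. Fix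 such $x$ and $\tau$. The ring $A\star_\alpha\mathcal{G}$ is the set of formal sums $\sum_g a_g\delta_g$ with $a_g\in A_g$, with product induced by $(a_g\delta_g)(b_h\delta_h)=a_g\alpha_g(b_h1_{g^{-1}})\delta_{gh}$ if $s(g)=t(h)$ and $0$ otherwise; it is $\mathcal{G}$-graded with components $A_g\delta_g$. Let $\mathcal{G}_0^2$ be the coarse groupoid on $\mathcal{G}_0$ (exactly one morphism $(y,z):y\to z$ for all $y,z\in\mathcal{G}_0$), and let $\beta$ be its global action on $A$ given by $B_{(y,z)}=A_z$ and $\beta_{(y,z)}=\alpha_{\tau_z}\alpha_{\tau_y^{-1}}:A_y\to A_z$; form the $\mathcal{G}_0^2$-graded ring $A\star_\beta\mathcal{G}_0^2$ in the same way. It is a left $A$-module through the ring homomorphism $a\mapsto\sum_{z\in\mathcal{G}_0}(a1_z)\delta_{(z,z)}$. A ring $R$ is von Neumann regular if $a\in aRa$ for all $a\in R$; a groupoid graded ring $R$ is graded von Neumann regular if $a\in aRa$ for all homogeneous $a\in R$. (i) If $A$ is von Neumann regular and $I$ is a principal left ideal of $A\star_\beta\mathcal{G}_0^2$, then $I$ is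 a direct summand of $A\star_\beta\mathcal{G}_0^2$ as a left $A$-module. (ii) If $|\mathcal{G}_0|1_A$ is invertible in $A$, then the following are equivalent: (a) $A$ is von Neumann regular; (b) $A\star_\beta\mathcal{G}_0^2$ is graded von Neumann regular; (c) $A\star_\beta\mathcal{G}_0^2$ is von Neumann regular; (d) $A\star_\alpha\mathcal{G}$ is graded von Neumann regular. Moreover, if at least one of (a)–(d) holds and $\mathrm{tr}_{\alpha_{\mathcal{G}(x)}}(1_x)=\sum_{h\in\mathcal{G}(x)}\alpha_h(1_x1_{h^{-1}})$ is invertible in the ring $A_x$ (whose identity is $1_x$), where $\mathcal{G}(x)$ is the isotropy group of $x$, then (e) $A\star_\alpha\mathcal{G}$ is von Neumann regular. -/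

import Mathlib

open CategoryTheory

universe w v u

/-- The coarse groupoid `Y²` on a set `Y`: Mathlib's codiscrete category on `Y`, which has exactly one
morphism between any two objects. The unique morphism `y ⟶ z` is the pair `(y, z)`. -/
instance codiscreteGroupoid (Y : Type u) : Groupoid (Codiscrete Y) where
  inv _ := ()
  inv_comp _ := rfl
  comp_inv _ := rfl

instance codiscreteFinite (Y : Type u) [Finite Y] : Finite (Codiscrete Y) :=
  Finite.of_equiv Y codiscreteEquiv.symm

/-- A partial action `α = (A_g, α_g)` of a groupoid `G` on a ring `A`. Here `dom g` is `A_g`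
and `map g` is the ring isomorphism `α_g : A_{g⁻¹} → A_g`. For `g : x ⟶ y` the source is `x` and the
target is `y`; the product `g h` of a composable pair is `h ≫ g` in Mathlib's notation. -/
structure PartialAction (G : Type u) [Groupoid.{v} G] (A : Type w) [Ring A] where
  dom : ∀ {x y : G}, (x ⟶ y) → NonUnitalSubring A
  /-- `A_y` is a two-sided ideal of `A` for every object `y`. -/
  mul_mem_obj_left : ∀ (y : G) (r a : A), a ∈ dom (𝟙 y) → r * a ∈ dom (𝟙 y)
  mul_mem_obj_right : ∀ (y : G) (r a : A), a ∈ dom (𝟙 y) → a * r ∈ dom (𝟙 y)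
  /-- `A_g` is a two-sided ideal of `A_{t(g)}`. -/
  dom_le : ∀ {x y : G} (g : x ⟶ y), dom g ≤ dom (𝟙 y)
  mul_mem_left : ∀ {x y : G} (g : x ⟶ y) (r a : A), r ∈ dom (𝟙 y) → a ∈ dom g → r * a ∈ dom g
  mul_mem_right : ∀ {x y : G} (g : x ⟶ y) (r a : A), r ∈ dom (𝟙 y) → a ∈ dom g → a * r ∈ dom g
  map : ∀ {x y : G} (g : x ⟶ y), dom (Groupoid.inv g) ≃+* dom g
  map_id : ∀ (x : G) (a : dom (Groupoid.inv (𝟙 x))), (map (𝟙 x) a : A) = a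
  /-- `α_h⁻¹(A_{g⁻¹} ∩ A_h) ⊆ A_{(gh)⁻¹}`. -/
  mem_dom_comp : ∀ {x y z : G} (h : x ⟶ y) (g : y ⟶ z) (a : dom (Groupoid.inv h)),
    (map h a : A) ∈ dom (Groupoid.inv g) → (a : A) ∈ dom (Groupoid.inv (h ≫ g))
  /-- `α_{gh}(a) = α_g(α_h(a))` for `a ∈ α_h⁻¹(A_{g⁻¹} ∩ A_h)`. -/
  map_comp : ∀ {x y z : G} (h : x ⟶ y) (g : y ⟶ z) (a : dom (Groupoid.inv h))
    (ha : (map h a : A) ∈ dom (Groupoid.inv g)),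
    (map (h ≫ g) ⟨a, mem_dom_comp h g a ha⟩ : A) = map g ⟨map h a, ha⟩

/-- A unital partial action: `A_g = A 1_g` with `1_g` a central idempotent of `A`. The element `1_g` is
determined by `A_g`, as the identity element of that ring. -/
structure UnitalPartialAction (G : Type u) [Groupoid.{v} G] (A : Type w) [Ring A] extends
    PartialAction G A where
  one : ∀ {x y : G}, (x ⟶ y) → A
  one_central : ∀ {x y : G} (g : x ⟶ y) (a : A), one g * a = a * one g
  one_idem : ∀ {x y : G} (g : x ⟶ y), one g * one g = one g
  mem_dom_iff : ∀ {x y : G} (g : x ⟶ y) (a : A), a ∈ dom g ↔ ∃ b : A, a = b * one g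

namespace UnitalPartialAction

variable {G : Type u} [Groupoid.{v} G] {A : Type w} [Ring A] (α : UnitalPartialAction G A)

theorem one_mem {x y : G} (g : x ⟶ y) : α.one g ∈ α.dom g :=
  (α.mem_dom_iff g _).2 ⟨α.one g, (α.one_idem g).symm⟩

theorem mul_one_of_mem {x y : G} (g : x ⟶ y) {a : A} (ha : a ∈ α.dom g) : a * α.one g = a := by
  obtain ⟨b, rfl⟩ := (α.mem_dom_iff g _).1 ha
  rw [mul_assoc, α.one_idem]

theorem one_mul_of_mem {x y : G} (g : x ⟶ y) {a : A} (ha : a ∈ α.dom g) : α.one g * a = a := by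
  rw [α.one_central, α.mul_one_of_mem g ha]

theorem ideal_left {x y : G} (g : x ⟶ y) (r : A) {a : A} (ha : a ∈ α.dom g) : r * a ∈ α.dom g := by
  obtain ⟨b, rfl⟩ := (α.mem_dom_iff g _).1 ha
  exact (α.mem_dom_iff g _).2 ⟨r * b, (mul_assoc _ _ _).symm⟩

theorem ideal_right {x y : G} (g : x ⟶ y) (r : A) {a : A} (ha : a ∈ α.dom g) : a * r ∈ α.dom g := by
  obtain ⟨b, rfl⟩ := (α.mem_dom_iff g _).1 ha
  exact (α.mem_dom_iff g _).2 ⟨b * r, by rw [mul_assoc, α.one_central, mul_assoc]⟩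

/-- The map `a ↦ α_g(a 1_{g⁻¹})` from `A` to `A`. -/
def act {x y : G} (g : x ⟶ y) : A →+ A where
  toFun a := α.map g ⟨a * α.one (Groupoid.inv g), α.ideal_left _ a (α.one_mem _)⟩
  map_zero' := by
    have h : (⟨0 * α.one (Groupoid.inv g), α.ideal_left _ 0 (α.one_mem _)⟩ :
        α.dom (Groupoid.inv g)) = 0 := Subtype.ext (zero_mul _)
    rw [h, map_zero]; rfl
  map_add' a b := by
    have h : (⟨(a + b) * α.one (Groupoid.inv g), α.ideal_left _ (a + b) (α.one_mem _)⟩ :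
        α.dom (Groupoid.inv g)) = ⟨a * α.one (Groupoid.inv g), α.ideal_left _ a (α.one_mem _)⟩ +
          ⟨b * α.one (Groupoid.inv g), α.ideal_left _ b (α.one_mem _)⟩ := Subtype.ext (add_mul _ _ _)
    rw [h, map_add]; rfl

theorem act_mem {x y : G} (g : x ⟶ y) (a : A) : α.act g a ∈ α.dom g := Subtype.property _

theorem act_eq {x y : G} (g : x ⟶ y) (a : α.dom (Groupoid.inv g)) :
    α.act g a = α.map g a :=
  congrArg (fun t => (α.map g t : A)) (Subtype.ext (α.mul_one_of_mem _ a.2))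

theorem act_mul_one {x y : G} (g : x ⟶ y) (a : A) :
    α.act g (a * α.one (Groupoid.inv g)) = α.act g a :=
  congrArg (fun t => (α.map g t : A)) (Subtype.ext (α.mul_one_of_mem _
    (α.ideal_left _ a (α.one_mem _))))

theorem act_mul {x y : G} (g : x ⟶ y) (a b : A) :
    α.act g (a * b) = α.act g a * α.act g b := by
  have h : (⟨(a * b) * α.one (Groupoid.inv g), α.ideal_left _ (a * b) (α.one_mem _)⟩ :
      α.dom (Groupoid.inv g)) = ⟨a * α.one (Groupoid.inv g), α.ideal_left _ a (α.one_mem _)⟩ *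
        ⟨b * α.one (Groupoid.inv g), α.ideal_left _ b (α.one_mem _)⟩ := by
    apply Subtype.ext
    change a * b * α.one (Groupoid.inv g) =
      a * α.one (Groupoid.inv g) * (b * α.one (Groupoid.inv g))
    rw [mul_assoc a (α.one (Groupoid.inv g)), ← mul_assoc (α.one (Groupoid.inv g)) b,
      α.one_central _ b, mul_assoc b, α.one_idem, mul_assoc]
  change ((α.map g _ : α.dom g) : A) = _
  rw [h, map_mul]; rfl

theorem act_id (x : G) (a : A) : α.act (𝟙 x) a = a * α.one (𝟙 x) := by
  change ((α.map (𝟙 x) _ : α.dom (𝟙 x)) : A) = _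
  rw [α.map_id]
  have h : Groupoid.inv (𝟙 x) = 𝟙 x := by simp
  change a * α.one (Groupoid.inv (𝟙 x)) = _
  rw [h]

theorem act_comp {x y z : G} (h : x ⟶ y) (g : y ⟶ z) {a : A} (ha : a ∈ α.dom (Groupoid.inv h))
    (hb : α.act h a ∈ α.dom (Groupoid.inv g)) :
    a ∈ α.dom (Groupoid.inv (h ≫ g)) ∧ α.act (h ≫ g) a = α.act g (α.act h a) := by
  have e : α.act h a = α.map h ⟨a, ha⟩ := α.act_eq h ⟨a, ha⟩
  rw [e] at hb
  have m := α.mem_dom_comp h g ⟨a, ha⟩ hb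
  refine ⟨m, ?_⟩
  rw [e]
  exact (α.act_eq (h ≫ g) ⟨a, m⟩).trans
    ((α.map_comp h g ⟨a, ha⟩ hb).trans (α.act_eq g ⟨_, hb⟩).symm)

theorem act_inv_act {x y : G} (g : x ⟶ y) {a : A} (ha : a ∈ α.dom (Groupoid.inv g)) :
    α.act (Groupoid.inv g) (α.act g a) = a := by
  have h1 : α.act g a ∈ α.dom (Groupoid.inv (Groupoid.inv g)) := by
    have : Groupoid.inv (Groupoid.inv g) = g := by simp
    rw [this]; exact α.act_mem g a
  rw [← (α.act_comp g (Groupoid.inv g) ha h1).2, Groupoid.comp_inv, act_id]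
  exact α.mul_one_of_mem _ (α.dom_le _ ha)

theorem act_act_inv {x y : G} (g : x ⟶ y) {a : A} (ha : a ∈ α.dom g) :
    α.act g (α.act (Groupoid.inv g) a) = a := by
  have h : Groupoid.inv (Groupoid.inv g) = g := by simp
  have := α.act_inv_act (Groupoid.inv g) (a := a) (by rw [h]; exact ha)
  rwa [h] at this

theorem act_mem_comp {x y z : G} (h : x ⟶ y) (g : y ⟶ z) {b : A} (hb : b ∈ α.dom h) :
    α.act g b ∈ α.dom (h ≫ g) := by
  rw [← α.act_mul_one]
  have hc := α.ideal_right h (α.one (Groupoid.inv g)) hb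
  have hc' := α.ideal_left (Groupoid.inv g) b (α.one_mem _)
  have e1 : Groupoid.inv (Groupoid.inv g) = g := by simp
  have e2 : Groupoid.inv (Groupoid.inv h) = h := by simp
  have e3 : Groupoid.inv (Groupoid.inv g ≫ Groupoid.inv h) = h ≫ g := by simp
  have := (α.act_comp (Groupoid.inv g) (Groupoid.inv h)
    (a := α.act g (b * α.one (Groupoid.inv g))) (by rw [e1]; exact α.act_mem g _)
    (by rw [α.act_inv_act g hc', e2]; exact hc)).1
  rwa [e3] at this

theorem act_mul_act {x y z : G} (h : x ⟶ y) (g : y ⟶ z) {b : A} (hb : b ∈ α.dom h) (c : A) :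
    α.act g (b * α.act h c) = α.act g b * α.act (h ≫ g) c := by
  have hc := α.ideal_right h (α.one (Groupoid.inv g)) hb
  have hc' := α.ideal_left (Groupoid.inv g) b (α.one_mem _)
  obtain ⟨e, he, hee⟩ : ∃ e ∈ α.dom (Groupoid.inv h),
      α.act h e = b * α.one (Groupoid.inv g) :=
    ⟨_, α.act_mem _ _, α.act_act_inv h hc⟩
  have k1 := (α.act_comp h g he (by rw [hee]; exact hc')).2
  have k2 := (α.act_comp h g (a := e * c) (α.ideal_right _ c he)
    (by rw [α.act_mul, hee]; exact α.ideal_right _ _ hc')).2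
  rw [← α.act_mul_one g (b * _), mul_assoc, ← α.one_central, ← mul_assoc, ← hee, ← α.act_mul, ← k2,
    α.act_mul, k1, hee, α.act_mul_one]

/-! ### The partial skew groupoid ring -/

/-- The partial skew groupoid ring `A ⋆_α G`: formal sums `∑ a_g δ_g` with finite support and `a_g ∈ A_g`,
indexed by the set `Quiver.Total G` of all morphisms of `G`. -/
def SkewRing : Type (max u v w) := DirectSum (Quiver.Total G) fun p => α.dom p.hom

namespace SkewRing

noncomputable instance : AddCommGroup α.SkewRing :=
  inferInstanceAs (AddCommGroup (DirectSum (Quiver.Total G) fun p => α.dom p.hom))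

open Classical in
/-- The homogeneous element `a δ_g`, for a morphism `p = g` and `a ∈ A_g`. -/
noncomputable def single (p : Quiver.Total G) : α.dom p.hom →+ α.SkewRing :=
  DirectSum.of (fun p : Quiver.Total G => α.dom p.hom) p

theorem single_congr {x y : G} {g g' : x ⟶ y} (e : g = g') {a b : A} (ha : a ∈ α.dom g)
    (hb : b ∈ α.dom g') (hab : a = b) :
    single α ⟨x, y, g⟩ ⟨a, ha⟩ = single α ⟨x, y, g'⟩ ⟨b, hb⟩ := by
  subst e; subst hab; rfl

theorem mulSingle_mem (p q : Quiver.Total G) (h : q.right = p.left) (a : α.dom p.hom)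
    (b : α.dom q.hom) :
    (a : A) * α.act p.hom b ∈ α.dom (q.hom ≫ eqToHom h ≫ p.hom) := by
  obtain ⟨x, y, g⟩ := p
  obtain ⟨x', y', k⟩ := q
  dsimp only at h a b ⊢
  subst h
  apply α.ideal_left
  rw [eqToHom_refl, Category.id_comp]
  exact α.act_mem_comp k g b.2

open Classical in
/-- The product of homogeneous elements: `(a δ_g)(b δ_h) = a α_g(b 1_{g⁻¹}) δ_{gh}` if `s(g) = t(h)`,
and `0` otherwise. -/
noncomputable def mulSingle (p q : Quiver.Total G) (a : α.dom p.hom) (b : α.dom q.hom) : α.SkewRing :=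
  if h : q.right = p.left then
    single α ⟨q.left, p.right, q.hom ≫ eqToHom h ≫ p.hom⟩
      ⟨(a : A) * α.act p.hom b, mulSingle_mem α p q h a b⟩
  else 0

theorem mulSingle_comp {x y z : G} (h : x ⟶ y) (g : y ⟶ z) (a : α.dom g) (b : α.dom h) :
    mulSingle α ⟨y, z, g⟩ ⟨x, y, h⟩ a b =
      single α ⟨x, z, h ≫ g⟩ ⟨(a : A) * α.act g b, α.ideal_left _ _ (α.act_mem_comp h g b.2)⟩ := by
  unfold mulSingle
  rw [dif_pos rfl]
  exact single_congr α (by simp) _ _ rfl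

theorem mulSingle_of_ne (p q : Quiver.Total G) (h : q.right ≠ p.left) (a : α.dom p.hom)
    (b : α.dom q.hom) : mulSingle α p q a b = 0 := by
  unfold mulSingle
  rw [dif_neg h]

theorem mulSingle_add_left (p q : Quiver.Total G) (a a' : α.dom p.hom) (b : α.dom q.hom) :
    mulSingle α p q (a + a') b = mulSingle α p q a b + mulSingle α p q a' b := by
  unfold mulSingle
  split_ifs with h
  · rw [← map_add]
    exact congrArg _ (Subtype.ext (add_mul _ _ _))
  · simp

theorem mulSingle_add_right (p q : Quiver.Total G) (a : α.dom p.hom) (b b' : α.dom q.hom) :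
    mulSingle α p q a (b + b') = mulSingle α p q a b + mulSingle α p q a b' := by
  unfold mulSingle
  split_ifs with h
  · rw [← map_add]
    refine congrArg _ (Subtype.ext ?_)
    change (a : A) * α.act p.hom ((b : A) + b') = a * α.act p.hom b + a * α.act p.hom b'
    rw [map_add, mul_add]
  · simp

/-- `mulSingle` as a biadditive map. -/
noncomputable def mulSingleHom (p q : Quiver.Total G) :
    α.dom p.hom →+ α.dom q.hom →+ α.SkewRing :=
  AddMonoidHom.mk' (fun a => AddMonoidHom.mk' (mulSingle α p q a) (mulSingle_add_right α p q a))
    fun a a' => AddMonoidHom.ext fun b => mulSingle_add_left α p q a a' b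

open Classical in
/-- The multiplication of `A ⋆_α G`: the biadditive extension of `mulSingle`. -/
noncomputable def mulHom : α.SkewRing →+ α.SkewRing →+ α.SkewRing :=
  DirectSum.toAddMonoid fun p => AddMonoidHom.flip
    (DirectSum.toAddMonoid fun q => AddMonoidHom.flip (mulSingleHom α p q))

noncomputable instance : Mul α.SkewRing := ⟨fun c d => mulHom α c d⟩

theorem mul_def (c d : α.SkewRing) : c * d = mulHom α c d := rfl

theorem single_mul_single (p q : Quiver.Total G) (a : α.dom p.hom) (b : α.dom q.hom) :
    single α p a * single α q b = mulSingle α p q a b := by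
  classical
  change mulHom α (single α p a) (single α q b) = _
  unfold mulHom single
  erw [DirectSum.toAddMonoid_of, AddMonoidHom.flip_apply, DirectSum.toAddMonoid_of]
  rfl

theorem single_comp {x y z : G} (h : x ⟶ y) (g : y ⟶ z) (a : α.dom g) (b : α.dom h) :
    single α ⟨y, z, g⟩ a * single α ⟨x, y, h⟩ b =
      single α ⟨x, z, h ≫ g⟩ ⟨(a : A) * α.act g b, α.ideal_left _ _ (α.act_mem_comp h g b.2)⟩ := by
  rw [single_mul_single, mulSingle_comp]

theorem single_mul_single_of_ne (p q : Quiver.Total G) (h : q.right ≠ p.left) (a : α.dom p.hom)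
    (b : α.dom q.hom) : single α p a * single α q b = 0 := by
  rw [single_mul_single, mulSingle_of_ne α p q h]

variable {α} in
theorem induction {P : α.SkewRing → Prop} (c : α.SkewRing) (h0 : P 0)
    (h1 : ∀ p a, P (single α p a)) (h2 : ∀ c d, P c → P d → P (c + d)) : P c := by
  classical
  exact DirectSum.induction_on c h0 h1 h2

theorem single_mul_assoc (p q r : Quiver.Total G) (a : α.dom p.hom) (b : α.dom q.hom)
    (c : α.dom r.hom) :
    single α p a * single α q b * single α r c = single α p a * (single α q b * single α r c) := by
  have zl : ∀ d : α.SkewRing, 0 * d = 0 := fun d => by simp [mul_def]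
  have zr : ∀ d : α.SkewRing, d * 0 = 0 := fun d => by simp [mul_def]
  obtain ⟨x, y, g⟩ := p
  obtain ⟨x', y', h⟩ := q
  obtain ⟨x'', y'', k⟩ := r
  dsimp only at a b c
  by_cases e1 : y' = x
  · subst e1
    by_cases e2 : y'' = x'
    · subst e2
      rw [single_comp, single_comp, single_comp, single_comp]
      refine single_congr α (Category.assoc _ _ _).symm _ _ ?_
      dsimp only
      rw [α.act_mul_act h g b.2, mul_assoc]
    · rw [single_comp, single_mul_single_of_ne, single_mul_single_of_ne, zr] <;> exact e2
  · rw [single_mul_single_of_ne α ⟨x, y, g⟩ ⟨x', y', h⟩ e1, zl]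
    by_cases e2 : y'' = x'
    · subst e2
      rw [single_comp, single_mul_single_of_ne]
      exact e1
    · rw [single_mul_single_of_ne α ⟨x', y', h⟩ ⟨x'', y'', k⟩ e2, zr]

noncomputable instance : NonUnitalRing α.SkewRing where
  left_distrib a b c := by simp [mul_def]
  right_distrib a b c := by simp [mul_def]
  zero_mul a := by simp [mul_def]
  mul_zero a := by simp [mul_def]
  mul_assoc a b c := by
    have ad : ∀ x y z : α.SkewRing, (x + y) * z = x * z + y * z := fun x y z => by simp [mul_def]
    have da : ∀ x y z : α.SkewRing, x * (y + z) = x * y + x * z := fun x y z => by simp [mul_def]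
    have zl : ∀ d : α.SkewRing, 0 * d = 0 := fun d => by simp [mul_def]
    have zr : ∀ d : α.SkewRing, d * 0 = 0 := fun d => by simp [mul_def]
    induction a using induction with
    | h0 => simp only [zl]
    | h2 a a' ha ha' => simp only [ad, ha, ha']
    | h1 p a =>
      induction b using induction with
      | h0 => simp only [zl, zr]
      | h2 b b' hb hb' => simp only [ad, da, hb, hb']
      | h1 q b =>
        induction c using induction with
        | h0 => simp only [zr]
        | h2 c c' hc hc' => simp only [da, hc, hc']
        | h1 r c => exact single_mul_assoc α p q r a b c

/-- For `a ∈ A` and an object `z`, the element `(a 1_z) δ_z`. -/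
noncomputable def objSingle (z : G) (a : A) : α.SkewRing :=
  single α ⟨z, z, 𝟙 z⟩ ⟨a * α.one (𝟙 z), α.ideal_left _ a (α.one_mem _)⟩

theorem objSingle_mul_single {x y : G} (g : x ⟶ y) (a : A) (b : α.dom g) :
    objSingle α y a * single α ⟨x, y, g⟩ b =
      single α ⟨x, y, g⟩ ⟨a * b, α.ideal_left _ a b.2⟩ := by
  unfold objSingle
  rw [single_comp]
  refine single_congr α (Category.comp_id _) _ _ ?_
  dsimp only
  rw [act_id, α.mul_one_of_mem _ (α.dom_le g b.2), mul_assoc, α.one_mul_of_mem _ (α.dom_le g b.2)]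

theorem objSingle_mul_single_of_ne (z : G) (p : Quiver.Total G) (h : p.right ≠ z) (a : A)
    (b : α.dom p.hom) : objSingle α z a * single α p b = 0 :=
  single_mul_single_of_ne α _ _ h _ _

theorem single_mul_objSingle_one {x y : G} (g : x ⟶ y) (b : α.dom g) :
    single α ⟨x, y, g⟩ b * objSingle α x 1 = single α ⟨x, y, g⟩ b := by
  unfold objSingle
  rw [single_comp]
  refine single_congr α (Category.id_comp _) _ _ ?_
  dsimp only
  have key : α.act g (α.one (𝟙 x)) = α.act g 1 := by
    rw [← α.act_mul_one g (α.one (𝟙 x)), ← α.act_mul_one g 1, one_mul,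
      α.one_mul_of_mem _ (α.dom_le _ (α.one_mem _))]
  have key2 : (b : A) * α.act g 1 = b := by
    conv_lhs => rw [← α.act_act_inv g b.2]
    rw [← α.act_mul, mul_one, α.act_act_inv g b.2]
  rw [one_mul, key, key2]

theorem single_mul_objSingle_of_ne (z : G) (p : Quiver.Total G) (h : z ≠ p.left) (a : A)
    (b : α.dom p.hom) : single α p b * objSingle α z a = 0 :=
  single_mul_single_of_ne α _ _ h _ _

/-- The map `φ : A → A ⋆_α G`, `φ(a) = ∑_z (a 1_z) δ_z`, for finitely many objects. -/
noncomputable def embed [Finite G] (a : A) : α.SkewRing := ∑ᶠ z : G, objSingle α z a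

theorem embed_mul_single [Finite G] {x y : G} (g : x ⟶ y) (a : A) (b : α.dom g) :
    embed α a * single α ⟨x, y, g⟩ b = single α ⟨x, y, g⟩ ⟨a * b, α.ideal_left _ a b.2⟩ := by
  classical
  let _ := Fintype.ofFinite G
  unfold embed
  rw [finsum_eq_sum_of_fintype, Finset.sum_mul, Finset.sum_eq_single y,
    objSingle_mul_single]
  · intro z _ hz
    exact objSingle_mul_single_of_ne α z _ (Ne.symm hz) _ _
  · simp

theorem single_mul_embed_one [Finite G] {x y : G} (g : x ⟶ y) (b : α.dom g) :
    single α ⟨x, y, g⟩ b * embed α 1 = single α ⟨x, y, g⟩ b := by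
  classical
  let _ := Fintype.ofFinite G
  unfold embed
  rw [finsum_eq_sum_of_fintype, Finset.mul_sum, Finset.sum_eq_single x,
    single_mul_objSingle_one]
  · intro z _ hz
    exact single_mul_objSingle_of_ne α z _ hz _ _
  · simp

/-- If `G` has finitely many objects, `A ⋆_α G` is a unital ring with identity `∑_z 1_z δ_z`. -/
noncomputable instance [Finite G] : Ring α.SkewRing where
  __ := (inferInstance : NonUnitalRing α.SkewRing)
  one := embed α 1
  one_mul c := by
    change embed α 1 * c = c
    induction c using induction with
    | h0 => exact mul_zero _
    | h2 c d hc hd => rw [mul_add, hc, hd]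
    | h1 p a =>
      obtain ⟨x, y, g⟩ := p
      rw [embed_mul_single]
      exact congrArg _ (Subtype.ext (one_mul _))
  mul_one c := by
    change c * embed α 1 = c
    induction c using induction with
    | h0 => exact zero_mul _
    | h2 c d hc hd => rw [add_mul, hc, hd]
    | h1 p a =>
      obtain ⟨x, y, g⟩ := p
      exact single_mul_embed_one α g a

theorem one_def [Finite G] : (1 : α.SkewRing) = embed α 1 := rfl

theorem objSingle_add (z : G) (a b : A) :
    objSingle α z (a + b) = objSingle α z a + objSingle α z b := by
  unfold objSingle
  rw [← map_add]
  exact congrArg _ (Subtype.ext (add_mul _ _ _))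

/-- The ring homomorphism `φ : A → A ⋆_α G`, `φ(a) = ∑_z (a 1_z) δ_z`. -/
noncomputable def embedHom [Finite G] : A →+* α.SkewRing :=
  RingHom.mk' ⟨⟨embed α, rfl⟩, fun a b => by
    classical
    let _ := Fintype.ofFinite G
    change embed α (a * b) = embed α a * embed α b
    conv_rhs => rw [embed.eq_def α b]
    unfold embed
    simp only [finsum_eq_sum_of_fintype]
    rw [Finset.mul_sum]
    refine Finset.sum_congr rfl fun z _ => ?_
    have := embed_mul_single α (𝟙 z) a ⟨b * α.one (𝟙 z), α.ideal_left _ b (α.one_mem _)⟩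
    unfold embed at this
    rw [finsum_eq_sum_of_fintype] at this
    unfold objSingle at this ⊢
    rw [this]
    exact single_congr α rfl _ _ (mul_assoc _ _ _)⟩
    fun a b => by
      classical
      let _ := Fintype.ofFinite G
      change embed α (a + b) = embed α a + embed α b
      unfold embed
      simp only [finsum_eq_sum_of_fintype, objSingle_add, Finset.sum_add_distrib]

/-- `A ⋆_α G` as a left `A`-module through `φ`. -/
noncomputable instance [Finite G] : Module A α.SkewRing := Module.compHom _ (embedHom α)

theorem smul_def [Finite G] (a : A) (c : α.SkewRing) : a • c = embedHom α a * c := rfl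

instance [Finite G] : IsScalarTower A α.SkewRing α.SkewRing :=
  ⟨fun a c d => by simp only [smul_def, smul_eq_mul, mul_assoc]⟩

end SkewRing

end UnitalPartialAction

/-! ### Groupoid gradings and von Neumann regularity -/

/-- A `G`-grading of a ring `R` by a groupoid `G`: additive subgroups `R_g` with `R = ⨁ R_g`,
`R_g R_h ⊆ R_{gh}` if `s(g) = t(h)`, and `R_g R_h = 0` otherwise. -/
structure GroupoidGrading (G : Type u) [Groupoid.{v} G] (R : Type w) [NonUnitalRing R] where
  component : Quiver.Total G → AddSubgroup R
  isInternal : Function.Bijective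
    (open Classical in DirectSum.coeAddMonoidHom component)
  mul_mem : ∀ {x y z : G} (h : x ⟶ y) (g : y ⟶ z) (a b : R), a ∈ component ⟨y, z, g⟩ →
    b ∈ component ⟨x, y, h⟩ → a * b ∈ component ⟨x, z, h ≫ g⟩
  mul_eq_zero : ∀ (p q : Quiver.Total G) (a b : R), q.right ≠ p.left → a ∈ component p →
    b ∈ component q → a * b = 0

/-- `R` is von Neumann regular: `a ∈ a R a` for all `a ∈ R`. -/
def IsVonNeumannRegular (R : Type w) [NonUnitalRing R] : Prop :=
  ∀ a : R, ∃ r : R, a = a * r * a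

/-- `R` is graded von Neumann regular: `a ∈ a R a` for every homogeneous element `a`. -/
def GroupoidGrading.IsVonNeumannRegular {G : Type u} [Groupoid.{v} G] {R : Type w} [NonUnitalRing R]
    (𝓡 : GroupoidGrading G R) : Prop :=
  ∀ (p : Quiver.Total G) (a : R), a ∈ 𝓡.component p → ∃ r : R, a = a * r * a

namespace UnitalPartialAction

variable {G : Type u} [Groupoid.{v} G] {A : Type w} [Ring A] (α : UnitalPartialAction G A)

/-- The canonical `G`-grading of `A ⋆_α G`, with components `(A ⋆_α G)_g = A_g δ_g`. -/
noncomputable def SkewRing.grading : GroupoidGrading G α.SkewRing where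
  component p := (SkewRing.single α p).range
  isInternal := by
    classical
    let e : ∀ p : Quiver.Total G, α.dom p.hom ≃+ (SkewRing.single α p).range := fun p =>
      AddMonoidHom.ofInjective (DirectSum.of_injective (β := fun p : Quiver.Total G => α.dom p.hom) p)
    let E : α.SkewRing ≃+ DirectSum (Quiver.Total G) fun p => (SkewRing.single α p).range :=
      DFinsupp.mapRange.addEquiv e
    have key : ∀ c : α.SkewRing, DirectSum.coeAddMonoidHom
        (fun p => (SkewRing.single α p).range) (E c) = c := by
      intro c
      induction c using SkewRing.induction with
      | h0 => simp
      | h2 c d hc hd => rw [map_add, map_add, hc, hd]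
      | h1 p a =>
        have : E (SkewRing.single α p a) = DirectSum.of _ p (e p a) :=
          DFinsupp.mapRange_single (f := fun p => e p) (hf := fun p => map_zero (e p))
        rw [this, DirectSum.coeAddMonoidHom_of]
        rfl
    have h2 : Function.Bijective (DirectSum.coeAddMonoidHom
        (fun p => (SkewRing.single α p).range) ∘ E) := by
      have : (DirectSum.coeAddMonoidHom (fun p => (SkewRing.single α p).range) ∘ E) = id :=
        funext key
      rw [this]; exact Function.bijective_id
    convert (Function.Bijective.of_comp_iff _ E.bijective).1 h2
  mul_mem h g a b := by
    rintro ⟨a, rfl⟩ ⟨b, rfl⟩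
    rw [SkewRing.single_comp]
    exact ⟨_, rfl⟩
  mul_eq_zero p q a b h := by
    rintro ⟨a, rfl⟩ ⟨b, rfl⟩
    exact SkewRing.single_mul_single_of_ne α p q h a b

/-! ### Group-type partial actions -/

open Classical in
/-- `A` is the internal direct sum `⨁_z A_z` of the ideals attached to the objects of `G`. -/
def IsDirectSumOfObjects : Prop := DirectSum.IsInternal fun z : G => α.dom (𝟙 z)

/-- `τ = (τ_y)` is a transversal for `x` (that is, `τ_y : x ⟶ y` and `τ_x = 𝟙 x`) which witnesses that `α` is
group-type: `A_{τ_y⁻¹} = A_x` and `A_{τ_y} = A_y` for all objects `y`. The existence of such a family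
forces `G` to be connected. -/
structure IsGroupType {x : G} (τ : ∀ y : G, x ⟶ y) : Prop where
  base : τ x = 𝟙 x
  dom_inv : ∀ y : G, α.dom (Groupoid.inv (τ y)) = α.dom (𝟙 x)
  dom_eq : ∀ y : G, α.dom (τ y) = α.dom (𝟙 y)

variable {α}

/-- The isomorphism `β_{(y,z)} = α_{τ_z} α_{τ_y⁻¹} : A_y → A_z`. -/
def IsGroupType.betaMap {x : G} {τ : ∀ y : G, x ⟶ y} (hτ : α.IsGroupType τ) (y z : G) :
    α.dom (𝟙 y) ≃+* α.dom (𝟙 z) :=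
  (RingEquiv.nonUnitalSubringCongr (by rw [← hτ.dom_eq y]; simp :
    α.dom (𝟙 y) = α.dom (Groupoid.inv (Groupoid.inv (τ y))))).trans <|
  (α.map (Groupoid.inv (τ y))).trans <|
  (RingEquiv.nonUnitalSubringCongr ((hτ.dom_inv y).trans (hτ.dom_inv z).symm)).trans <|
  (α.map (τ z)).trans <|
  RingEquiv.nonUnitalSubringCongr (hτ.dom_eq z)

theorem IsGroupType.betaMap_eq {x : G} {τ : ∀ y : G, x ⟶ y} (hτ : α.IsGroupType τ) (y z : G)
    (a : α.dom (𝟙 y)) :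
    (hτ.betaMap y z a : A) = α.act (τ z) (α.act (Groupoid.inv (τ y)) a) := by
  have h1 : α.dom (𝟙 y) = α.dom (Groupoid.inv (Groupoid.inv (τ y))) := by
    rw [← hτ.dom_eq y]; simp
  have h2 := (hτ.dom_inv y).trans (hτ.dom_inv z).symm
  have e1 : α.act (Groupoid.inv (τ y)) a = α.map (Groupoid.inv (τ y)) ⟨a, h1 ▸ a.2⟩ :=
    α.act_eq (Groupoid.inv (τ y)) ⟨a, h1 ▸ a.2⟩
  rw [e1]
  exact (α.act_eq (τ z) ⟨_, h2 ▸ (α.map (Groupoid.inv (τ y)) ⟨a, h1 ▸ a.2⟩).2⟩).symm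

/-- The global action `β = (B_u, β_u)` of the coarse groupoid `G₀²` on `A`: for `u = (y, z)`,
`B_u = A_z` and `β_u = α_{τ_z} α_{τ_y⁻¹} : A_y → A_z`. -/
def IsGroupType.beta {x : G} {τ : ∀ y : G, x ⟶ y} (hτ : α.IsGroupType τ) :
    UnitalPartialAction (Codiscrete G) A where
  dom {_ z} _ := α.dom (𝟙 z.as)
  mul_mem_obj_left y r _ := α.mul_mem_obj_left y.as r _
  mul_mem_obj_right y r _ := α.mul_mem_obj_right y.as r _
  dom_le _ := le_rfl
  mul_mem_left _ r _ _ ha := α.ideal_left _ r ha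
  mul_mem_right _ r _ _ ha := α.ideal_right _ r ha
  map {y z} _ := hτ.betaMap y.as z.as
  map_id y a := by
    refine (hτ.betaMap_eq y.as y.as a).trans ?_
    exact α.act_act_inv _ (by rw [hτ.dom_eq]; exact a.2)
  mem_dom_comp _ _ a _ := a.2
  map_comp {p y z} h g a ha := by
    refine (hτ.betaMap_eq p.as z.as a).trans ?_
    refine Eq.trans ?_ (hτ.betaMap_eq y.as z.as (hτ.betaMap p.as y.as a)).symm
    rw [hτ.betaMap_eq p.as y.as a, α.act_inv_act]
    rw [hτ.dom_inv y.as, ← hτ.dom_inv p.as]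
    exact α.act_mem _ _
  one {_ z} _ := α.one (𝟙 z.as)
  one_central _ a := α.one_central _ a
  one_idem _ := α.one_idem _
  mem_dom_iff _ a := α.mem_dom_iff _ a

variable (α)

/-- The trace map of the restriction of `α` to a partial action of the isotropy group `G(x)` on `A_x`:
`a ↦ ∑_{h ∈ G(x)} α_h(a 1_{h⁻¹})` (used for finite `G(x)`). -/
noncomputable def isotropyTrace (x : G) (a : A) : A := ∑ᶠ h : x ⟶ x, α.act h a

/-- `a` is an invertible element of the ring `A_x`, whose identity element is `1_x`. -/
def IsInvertibleAt (x : G) (a : A) : Prop :=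
  a ∈ α.dom (𝟙 x) ∧ ∃ b ∈ α.dom (𝟙 x), a * b = α.one (𝟙 x) ∧ b * a = α.one (𝟙 x)

end UnitalPartialAction

/-!
Write `S = A ⋆_α G`, `δ_g = 1_g δ_g` and `t = ∑_g 1_g ∈ A`, the last sum over all morphisms of `G`.

If `A` is von Neumann regular, then for each element `m` of a submodule of `Aⁿ` there is a linear
functional `f` with `f(m) m = m` (`IsVonNeumannRegular.exists_functional_smul_eq`). This makes every
finitely generated submodule the image of a linear projection
(`Submodule.exists_projection_of_exists_functional`). As a left `A`-module, `S` is finitely generated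
and embeds into a finite power of `A` through its coefficients, so each principal left ideal `I = S l`
is the image of an `A`-linear projection `π : S → S`. Applied to `β` this is part (i).

Averaging as in Maschke's theorem, `c ↦ ∑_g δ_g π(δ_{g⁻¹} c)` is `S`-linear with values in `I`, and on
`I` it is multiplication by the image of `t` in `S`. If `t` is a unit, then `l ∈ l S l`, so `S` is von
Neumann regular (`SkewRing.isVonNeumannRegular_of_isUnit_sum`). For `β` one has `t = |G₀| 1_A`; for a
group-type action `t = |G₀| ∑_z α_{τ_z}(tr(1_x))`, because `α_{τ_z}` carries `1_h` to `1_g` for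
`g = τ_z h τ_y⁻¹`. This gives (a) ⇒ (c) and (e) without passing through matrix rings.

For graded regularity: if `a = a r a` in `A` with `a ∈ A_g`, then `α_{g⁻¹}(r 1_g) δ_{g⁻¹}` is a
quasi-inverse of `a δ_g`; conversely, the coefficient of `(a 1_z) δ_z = (a 1_z) δ_z c (a 1_z) δ_z` at the
identity of `z` shows that `a 1_z ∈ a 1_z A a 1_z`, and these relations add up over `z`.
-/

/-! ### Finitely generated submodules over a von Neumann regular ring -/

section Module

variable {A : Type*} [Ring A] {M : Type*} [AddCommGroup M] [Module A M]

/-- For finitely many coordinates of `m` there is a functional `f` such that `f(m)` fixes all of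
them. This is the finite direct sum theorem for Zelmanowitz-regular modules, in a form that also
covers submodules of `Aⁿ`. -/
theorem IsVonNeumannRegular.exists_functional (hA : IsVonNeumannRegular A) {ι : Type*}
    (φ : ι → M →ₗ[A] A) (s : Finset ι) (m : M) :
    ∃ f : M →ₗ[A] A, ∀ i ∈ s, f m * φ i m = φ i m := by
  classical
  induction s using Finset.induction_on with
  | empty => exact ⟨0, by simp⟩
  | insert j s _ ih =>
    obtain ⟨f, hf⟩ := ih
    obtain ⟨r, hr⟩ := hA (φ j m - f m * φ j m)
    -- With `w = φ_j (m - f(m) m) = w r w`, the functional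
    -- `x ↦ f(x) + φ_j (x - f(x) m) r (1 - f(m))` takes the value `f(m) + w r (1 - f(m))` at `m`;
    -- the factor `1 - f(m)` kills the coordinates already fixed by `f(m)`.
    refine ⟨f + (LinearMap.toSpanSingleton A A (r * (1 - f m))).comp
      ((φ j).comp (LinearMap.id - (LinearMap.toSpanSingleton A M m).comp f)), fun i hi => ?_⟩
    have e : (f + (LinearMap.toSpanSingleton A A (r * (1 - f m))).comp
        ((φ j).comp (LinearMap.id - (LinearMap.toSpanSingleton A M m).comp f)) : M →ₗ[A] A) m =
        f m + (φ j m - f m * φ j m) * (r * (1 - f m)) := by simp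
    rw [e]
    rcases Finset.mem_insert.1 hi with rfl | hi
    · rw [add_mul, show ∀ w : A, w * (r * (1 - f m)) * φ i m = w * r * (φ i m - f m * φ i m) by
        intro w; noncomm_ring, ← hr]
      abel
    · rw [add_mul, mul_assoc, mul_assoc r, sub_mul 1, one_mul, hf i hi]
      simp

theorem IsVonNeumannRegular.exists_functional_smul_eq (hA : IsVonNeumannRegular A) {ι : Type*}
    [Finite ι] (φ : ι → M →ₗ[A] A) (hφ : ∀ m m' : M, (∀ i, φ i m = φ i m') → m = m') (m : M) :
    ∃ f : M →ₗ[A] A, f m • m = m := by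
  have := Fintype.ofFinite ι
  obtain ⟨f, hf⟩ := hA.exists_functional φ Finset.univ m
  exact ⟨f, hφ _ _ fun i => by simpa using hf i (Finset.mem_univ i)⟩

/-- If every element `m` of `M` satisfies `f(m) m = m` for some functional `f`, then every finitely
generated submodule of `M` is a direct summand. -/
theorem Submodule.exists_projection_of_exists_functional
    (h : ∀ m : M, ∃ f : M →ₗ[A] A, f m • m = m) {N : Submodule A M} (hN : N.FG) :
    ∃ π : M →ₗ[A] M, (∀ m, π m ∈ N) ∧ ∀ m ∈ N, π m = m := by
  classical
  obtain ⟨s, rfl⟩ := hN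
  suffices H : ∃ π : M →ₗ[A] M, (∀ m, π m ∈ Submodule.span A (s : Set M)) ∧ ∀ m ∈ s, π m = m by
    obtain ⟨π, h1, h2⟩ := H
    exact ⟨π, h1, fun m hm => LinearMap.eqOn_span (f := π) (g := LinearMap.id) h2 hm⟩
  induction s using Finset.induction_on with
  | empty => exact ⟨0, by simp⟩
  | insert m s _ ih =>
    obtain ⟨π, h1, h2⟩ := ih
    obtain ⟨f, hf⟩ := h (m - π m)
    have le : Submodule.span A (s : Set M) ≤ Submodule.span A ((insert m s : Finset M) : Set M) :=
      Submodule.span_mono (by simp)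
    have hm : m - π m ∈ Submodule.span A ((insert m s : Finset M) : Set M) :=
      sub_mem (Submodule.subset_span (by simp)) (le (h1 m))
    -- `x ↦ f(x) (m - π m)` fixes `m - π m`, the part of the new generator missed by `π`.
    refine ⟨π + (LinearMap.toSpanSingleton A M (m - π m)).comp (f.comp (LinearMap.id - π)),
      fun x => add_mem (le (h1 x)) (Submodule.smul_mem _ _ hm), fun x hx => ?_⟩
    have e : (π + (LinearMap.toSpanSingleton A M (m - π m)).comp
        (f.comp (LinearMap.id - π)) : M →ₗ[A] M) x =
        π x + f (x - π x) • (m - π m) := by simp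
    rw [e]
    rcases Finset.mem_insert.1 hx with rfl | hx
    · rw [hf]; abel
    · rw [h2 x hx]; simp

end Module

/-! ### Identities for the idempotents `1_g` -/

namespace UnitalPartialAction

variable {G : Type u} [Groupoid.{v} G] {A : Type w} [Ring A] (α : UnitalPartialAction G A)

theorem act_act_inv_eq {y z : G} (g : y ⟶ z) (a : A) :
    α.act g (α.act (Groupoid.inv g) a) = a * α.one g := by
  have e : Groupoid.inv (Groupoid.inv g) = g := by simp
  rw [← α.act_mul_one (Groupoid.inv g) a, e, α.act_act_inv g (α.ideal_left _ _ (α.one_mem g))]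

/-- `α_h(1_k 1_{h⁻¹}) = 1_h 1_{hk}`: `α_h` maps `A_{h⁻¹} ∩ A_k` onto `A_h ∩ A_{hk}`. -/
theorem act_one_comp {y z w : G} (k : y ⟶ z) (h : z ⟶ w) :
    α.act h (α.one k) = α.one h * α.one (k ≫ h) := by
  have e1 : α.act h (α.one k) ∈ α.dom (k ≫ h) := α.act_mem_comp k h (α.one_mem k)
  have e2 := α.act_mem_comp (k ≫ h) (Groupoid.inv h) (α.one_mem (k ≫ h))
  have e3 : (k ≫ h) ≫ Groupoid.inv h = k := by simp
  rw [e3] at e2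
  have e4 : α.one h * α.one (k ≫ h) * α.act h (α.one k) = α.one h * α.one (k ≫ h) := by
    rw [α.one_central h, ← α.act_act_inv_eq h, ← α.act_mul, α.mul_one_of_mem k e2]
  rw [← e4, mul_assoc, α.one_mul_of_mem _ e1, α.one_mul_of_mem _ (α.act_mem h _)]

theorem one_eq_of_dom_eq {y z y' z' : G} {g : y ⟶ z} {h : y' ⟶ z'} (e : α.dom g = α.dom h) :
    α.one g = α.one h := by
  have h1 := α.one_mul_of_mem h (e ▸ α.one_mem g)
  have h2 := α.mul_one_of_mem g (e ▸ α.one_mem h)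
  rw [← h1, h2]

theorem act_one_obj {y z : G} (g : y ⟶ z) : α.act g (α.one (𝟙 y)) = α.one g := by
  rw [α.act_one_comp, Category.id_comp, α.one_idem]

/-! ### The skew groupoid ring as a left `A`-module -/

namespace SkewRing

/-- The coefficient `a_g ∈ A_g ⊆ A` of a formal sum `∑ a_g δ_g`. -/
noncomputable def coeff (p : Quiver.Total G) : α.SkewRing →+ A :=
  (AddSubgroup.subtype (α.dom p.hom).toAddSubgroup).comp
    (DFinsupp.evalAddMonoidHom (β := fun p : Quiver.Total G => α.dom p.hom) p)

theorem coeff_single_self (p : Quiver.Total G) (a : α.dom p.hom) :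
    coeff α p (single α p a) = a := by
  classical
  exact congrArg Subtype.val (DirectSum.of_eq_same (β := fun p : Quiver.Total G => α.dom p.hom) p a)

theorem coeff_single_of_ne {p q : Quiver.Total G} (h : p ≠ q) (a : α.dom p.hom) :
    coeff α q (single α p a) = 0 := by
  classical
  exact congrArg Subtype.val
    (DirectSum.of_eq_of_ne (β := fun p : Quiver.Total G => α.dom p.hom) p q a h.symm)

variable {α} in
theorem coeff_ext {c d : α.SkewRing} (h : ∀ p, coeff α p c = coeff α p d) : c = d := by
  classical
  exact DFinsupp.ext fun p => Subtype.ext (h p)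

theorem smul_single [Finite G] {y z : G} (g : y ⟶ z) (a : A) (b : α.dom g) :
    a • single α ⟨y, z, g⟩ b = single α ⟨y, z, g⟩ ⟨a * b, α.ideal_left _ a b.2⟩ :=
  embed_mul_single α g a b

theorem coeff_smul [Finite G] (p : Quiver.Total G) (a : A) (c : α.SkewRing) :
    coeff α p (a • c) = a * coeff α p c := by
  induction c using induction with
  | h0 => simp
  | h2 c d hc hd => rw [smul_add, map_add, map_add, hc, hd, mul_add]
  | h1 q b =>
    obtain ⟨y, z, g⟩ := q
    rw [smul_single]
    by_cases h : (⟨y, z, g⟩ : Quiver.Total G) = p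
    · subst h
      rw [coeff_single_self, coeff_single_self]
    · rw [coeff_single_of_ne α h, coeff_single_of_ne α h, mul_zero]

/-- The element `1_g δ_g`. -/
noncomputable def delta {y z : G} (g : y ⟶ z) : α.SkewRing :=
  single α ⟨y, z, g⟩ ⟨α.one g, α.one_mem g⟩

theorem single_eq_smul_delta [Finite G] {y z : G} (g : y ⟶ z) (a : α.dom g) :
    single α ⟨y, z, g⟩ a = (a : A) • delta α g := by
  rw [delta, smul_single]
  exact single_congr α rfl a.2 _ (α.mul_one_of_mem g a.2).symm

theorem delta_mul_single_of_ne {y z y' z' : G} (g : y ⟶ z) (k : y' ⟶ z') (h : z' ≠ y)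
    (a : α.dom k) : delta α g * single α ⟨y', z', k⟩ a = 0 :=
  single_mul_single_of_ne α _ _ h _ _

theorem delta_mul_single [Finite G] {y z w : G} (k : y ⟶ z) (g : z ⟶ w) (a : α.dom k) :
    delta α g * single α ⟨y, z, k⟩ a = α.act g a • delta α (k ≫ g) := by
  rw [delta, single_comp, delta, smul_single]
  refine single_congr α rfl _ _ ?_
  rw [α.one_mul_of_mem g (α.act_mem g _), α.mul_one_of_mem _ (α.act_mem_comp k g a.2)]

theorem delta_smul [Finite G] {y z : G} (g : y ⟶ z) (a : A) (c : α.SkewRing) :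
    delta α g * a • c = α.act g a • (delta α g * c) := by
  induction c using induction with
  | h0 => simp
  | h2 c d hc hd => rw [smul_add, mul_add, hc, hd, mul_add, smul_add]
  | h1 q b =>
    obtain ⟨y', z', k⟩ := q
    rw [smul_single]
    by_cases h : z' = y
    · subst h
      rw [delta_mul_single, delta_mul_single, smul_smul, α.act_mul]
    · rw [delta_mul_single_of_ne α g k h, delta_mul_single_of_ne α g k h, smul_zero]

theorem single_mul_delta [Finite G] {y z w : G} (k : y ⟶ z) (h : z ⟶ w) (a : α.dom h) :
    single α ⟨z, w, h⟩ a * delta α k = (a : A) • delta α (k ≫ h) := by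
  rw [delta, single_comp, delta, smul_single]
  refine single_congr α rfl _ _ ?_
  dsimp only
  rw [α.act_one_comp, ← mul_assoc, α.mul_one_of_mem h a.2]

theorem smul_delta_mul [Finite G] {y z : G} (g : y ⟶ z) (a : A) (c : α.SkewRing) :
    (a * α.one g) • (delta α g * c) = a • (delta α g * c) := by
  rw [mul_smul, ← smul_mul_assoc (α.one g), delta, smul_single]
  exact congrArg (fun d => a • (d * c)) (single_congr α rfl _ _ (α.one_idem g))

instance finite_total [Finite G] [∀ y z : G, Finite (y ⟶ z)] : Finite (Quiver.Total G) :=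
  Finite.of_surjective (fun s : Σ y z : G, (y ⟶ z) => (⟨s.1, s.2.1, s.2.2⟩ : Quiver.Total G))
    fun p => ⟨⟨p.left, p.right, p.hom⟩, rfl⟩

instance moduleFinite [Finite G] [∀ y z : G, Finite (y ⟶ z)] : Module.Finite A α.SkewRing := by
  refine ⟨Submodule.fg_def.2 ⟨Set.range fun p : Quiver.Total G => delta α p.hom,
    Set.finite_range _, eq_top_iff.2 fun c _ => ?_⟩⟩
  induction c using induction with
  | h0 => exact zero_mem _
  | h2 c d hc hd => exact add_mem (hc trivial) (hd trivial)
  | h1 p a =>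
    obtain ⟨y, z, g⟩ := p
    rw [single_eq_smul_delta]
    exact Submodule.smul_mem _ _ (Submodule.subset_span ⟨⟨y, z, g⟩, rfl⟩)

/-- Over a von Neumann regular ring `A`, each principal left ideal of `A ⋆_α G` is the image of an
`A`-linear projection. -/
theorem exists_projection_span_singleton [Finite G] [∀ y z : G, Finite (y ⟶ z)]
    (hA : IsVonNeumannRegular A) (l : α.SkewRing) :
    ∃ π : α.SkewRing →ₗ[A] α.SkewRing,
      (∀ c, π c ∈ Ideal.span {l}) ∧ ∀ c ∈ Ideal.span {l}, π c = c := by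
  have hfg : ((Ideal.span {l}).restrictScalars A).FG := by
    have : (Ideal.span {l}).restrictScalars A =
        Submodule.map ((LinearMap.toSpanSingleton α.SkewRing α.SkewRing l).restrictScalars A)
          ⊤ := by
      ext c
      simp [Ideal.mem_span_singleton']
    rw [this]
    exact (Module.Finite.fg_top).map _
  exact Submodule.exists_projection_of_exists_functional
    (hA.exists_functional_smul_eq
      (fun p => { coeff α p with map_smul' := coeff_smul α p }) fun _ _ h => coeff_ext h) hfg

/-! ### Averaging over the morphisms of `G` -/

/-- The image of `1_g` under `A → A ⋆_α G` is `δ_g δ_{g⁻¹} = 1_g δ_{t(g)}`, since `1_g` is orthogonal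
to `1_z` for `z ≠ t(g)`. -/
theorem embedHom_one [Finite G]
    (horth : ∀ y z : G, y ≠ z → α.one (𝟙 y) * α.one (𝟙 z) = 0) {y z : G} (g : y ⟶ z) :
    embedHom α (α.one g) = delta α g * delta α (Groupoid.inv g) := by
  classical
  have := Fintype.ofFinite G
  have e : delta α g * delta α (Groupoid.inv g) =
      single α ⟨z, z, 𝟙 z⟩ ⟨α.one g, α.dom_le g (α.one_mem g)⟩ := by
    rw [delta, delta, single_comp]
    refine single_congr α (by simp) _ _ ?_
    dsimp only
    rw [α.act_one_comp, Groupoid.inv_comp, ← mul_assoc, α.one_idem,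
      α.mul_one_of_mem _ (α.dom_le g (α.one_mem g))]
  rw [e]
  change embed α _ = _
  unfold embed
  rw [finsum_eq_sum_of_fintype, Finset.sum_eq_single z]
  · exact single_congr α rfl _ _ (α.mul_one_of_mem _ (α.dom_le g (α.one_mem g)))
  · intro z' _ hz
    unfold objSingle
    have : (⟨α.one g * α.one (𝟙 z'), α.ideal_left _ _ (α.one_mem _)⟩ : α.dom (𝟙 z')) = 0 := by
      apply Subtype.ext
      change α.one g * α.one (𝟙 z') = 0
      rw [← α.mul_one_of_mem _ (α.dom_le g (α.one_mem g)), mul_assoc, horth z z' hz.symm, mul_zero]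
    rw [this, map_zero]
  · simp

section Average

variable [Fintype G] [∀ y z : G, Fintype (y ⟶ z)]

/-- The average `c ↦ ∑_g δ_g π(δ_{g⁻¹} c)` of a self-map `π` of `A ⋆_α G` over all morphisms of `G`. -/
noncomputable def average (π : α.SkewRing → α.SkewRing) (c : α.SkewRing) : α.SkewRing :=
  ∑ y : G, ∑ z : G, ∑ g : y ⟶ z, delta α g * π (delta α (Groupoid.inv g) * c)

theorem average_single_mul (π : α.SkewRing →ₗ[A] α.SkewRing) {z w : G} (h : z ⟶ w) (a : α.dom h)
    (c : α.SkewRing) :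
    average α π (single α ⟨z, w, h⟩ a * c) = single α ⟨z, w, h⟩ a * average α π c := by
  classical
  unfold average
  rw [Finset.mul_sum]
  refine Finset.sum_congr rfl fun y _ => ?_
  rw [Finset.mul_sum, Finset.sum_eq_single w, Finset.sum_eq_single z]
  · rw [Finset.mul_sum]
    symm
    -- Only the `g` with target `w` contribute to the average of `a δ_h c`, and only the `k` with
    -- target `z` contribute to `a δ_h` times the average of `c`; they correspond by `g = h k`.
    refine Fintype.sum_equiv (Groupoid.isoEquivHom z w |>.symm h).homToEquiv _ _ fun k => ?_
    have e : ((Groupoid.isoEquivHom z w).symm h).homToEquiv k = k ≫ h := rfl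
    rw [e, ← mul_assoc, ← mul_assoc, single_mul_delta, delta_mul_single, smul_mul_assoc,
      smul_mul_assoc, map_smul, delta_smul, α.act_act_inv_eq, smul_delta_mul]
    simp
  · intro z' _ hz
    rw [Finset.mul_sum]
    refine Finset.sum_eq_zero fun g _ => ?_
    rw [← mul_assoc, delta, single_mul_single_of_ne α _ _ hz, zero_mul]
  · simp
  · intro z' _ hz
    refine Finset.sum_eq_zero fun g _ => ?_
    rw [← mul_assoc, delta_mul_single_of_ne α _ _ hz.symm, zero_mul, map_zero, mul_zero]
  · simp

/-- The average of an `A`-linear map is left `A ⋆_α G`-linear. -/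
theorem average_mul (π : α.SkewRing →ₗ[A] α.SkewRing) (c d : α.SkewRing) :
    average α π (c * d) = c * average α π d := by
  induction c using induction with
  | h0 => simp [average]
  | h2 c c' hc hc' =>
    rw [add_mul, add_mul, ← hc, ← hc']
    simp only [average, mul_add, map_add, Finset.sum_add_distrib]
  | h1 p a => exact average_single_mul α π p.hom a d

/-- On a left ideal fixed by `π`, the average of `π` is left multiplication by `∑_g δ_g δ_{g⁻¹}`. -/
theorem average_eq (π : α.SkewRing → α.SkewRing) (c : α.SkewRing)
    (h : ∀ r, π (r * c) = r * c) : average α π c = average α id 1 * c := by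
  simp only [average, h, id, mul_one, Finset.sum_mul, mul_assoc]

/-- Regularity passes from `A` to `A ⋆_α G` when `∑_g 1_g` is invertible, as in Maschke's theorem:
averaging an `A`-linear projection onto a principal left ideal gives an `A ⋆_α G`-linear one. -/
theorem isVonNeumannRegular_of_isUnit_sum (hA : IsVonNeumannRegular A)
    (horth : ∀ y z : G, y ≠ z → α.one (𝟙 y) * α.one (𝟙 z) = 0)
    (ht : IsUnit (∑ y : G, ∑ z : G, ∑ g : y ⟶ z, α.one g)) : IsVonNeumannRegular α.SkewRing := by
  intro l
  obtain ⟨π, h1, h2⟩ := exists_projection_span_singleton α hA l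
  have hT : IsUnit (average α id (1 : α.SkewRing)) := by
    have : average α id 1 = embedHom α (∑ y : G, ∑ z : G, ∑ g : y ⟶ z, α.one g) := by
      simp only [average, map_sum, embedHom_one α horth, id, mul_one]
    rw [this]
    exact ht.map _
  obtain ⟨T, hT⟩ := hT
  -- The average of the identity is both `A ⋆_α G`-linear and multiplication by `T`, so `T` is central.
  have hc : ∀ c : α.SkewRing, c * T = T * c := fun c => by
    have := average_mul α LinearMap.id c 1
    rw [LinearMap.id_coe, average_eq α id (c * 1) (fun _ => rfl), mul_one] at this
    rw [hT, this]
  have h3 : average α π l = T * l := by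
    rw [average_eq α π l fun r => h2 _ (Ideal.mul_mem_left _ r (Ideal.mem_span_singleton_self l)),
      hT]
  have h4 : average α π 1 ∈ Ideal.span {l} :=
    sum_mem fun _ _ => sum_mem fun _ _ => sum_mem fun _ _ => Ideal.mul_mem_left _ _ (h1 _)
  obtain ⟨r, hr⟩ := Ideal.mem_span_singleton'.1 h4
  have h5 : T * l = l * (r * l) := by rw [← h3, hr, ← average_mul, mul_one]
  refine ⟨r * ↑T⁻¹, ?_⟩
  have h6 : l * ↑T⁻¹ = ↑T⁻¹ * l := by
    rw [Units.eq_inv_mul_iff_mul_eq, ← mul_assoc, ← hc, mul_assoc, Units.mul_inv, mul_one]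
  rw [mul_assoc, mul_assoc, ← h6, ← mul_assoc, ← mul_assoc, mul_assoc l r l, ← h5, ← hc, mul_assoc,
    Units.mul_inv, mul_one]

end Average

/-! ### Graded regularity and regularity of the coefficient ring -/

/-- The identity component of `(a δ_z) c (b δ_z)` lies in `a A b`. -/
theorem exists_coeff_single_mul_mul_single {z : G} (a b : α.dom (𝟙 z)) (c : α.SkewRing) :
    ∃ r : A, coeff α ⟨z, z, 𝟙 z⟩ (single α ⟨z, z, 𝟙 z⟩ a * c * single α ⟨z, z, 𝟙 z⟩ b) =
      a * r * b := by
  induction c using induction with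
  | h0 => exact ⟨0, by simp⟩
  | h2 c d hc hd =>
    obtain ⟨r, hr⟩ := hc
    obtain ⟨r', hr'⟩ := hd
    exact ⟨r + r', by rw [mul_add, add_mul, map_add, hr, hr', mul_add, add_mul]⟩
  | h1 p r =>
    obtain ⟨y, w, g⟩ := p
    by_cases hw : w = z
    · subst hw
      by_cases hy : y = w
      · subst hy
        rw [single_comp, single_comp]
        by_cases hg : g = 𝟙 y
        · subst hg
          refine ⟨r, ?_⟩
          rw [single_congr α (g' := 𝟙 y) (by simp) _
            (α.ideal_left _ ((a : A) * r) b.2) ?_, coeff_single_self]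
          simp only [α.act_id, Category.comp_id]
          rw [α.mul_one_of_mem _ b.2, α.mul_one_of_mem _ r.2]
        · refine ⟨0, ?_⟩
          rw [coeff_single_of_ne]
          · simp
          · intro h
            injection h with _ _ h
            exact hg (by simpa using h)
      · refine ⟨0, ?_⟩
        rw [mul_assoc, single_mul_single_of_ne α ⟨y, w, g⟩ ⟨w, w, 𝟙 w⟩ (Ne.symm hy)]
        simp
    · refine ⟨0, ?_⟩
      rw [single_mul_single_of_ne α ⟨z, z, 𝟙 z⟩ ⟨y, w, g⟩ hw]
      simp

/-- A ring whose skew groupoid ring is graded von Neumann regular is itself von Neumann regular, if it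
is the sum of the ideals attached to the objects. -/
theorem isVonNeumannRegular_of_grading [Fintype G] (hsum : ∑ z : G, α.one (𝟙 z) = 1)
    (h : (grading α).IsVonNeumannRegular) : IsVonNeumannRegular A := by
  intro a
  have key : ∀ z : G, ∃ r : A, a * α.one (𝟙 z) = a * (r * α.one (𝟙 z)) * a := by
    intro z
    let b : α.dom (𝟙 z) := ⟨a * α.one (𝟙 z), α.ideal_left _ a (α.one_mem _)⟩
    obtain ⟨c, hc⟩ := h ⟨z, z, 𝟙 z⟩ (single α ⟨z, z, 𝟙 z⟩ b) ⟨b, rfl⟩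
    obtain ⟨r, hr⟩ := exists_coeff_single_mul_mul_single α b b c
    rw [← hc, coeff_single_self] at hr
    refine ⟨r, hr.trans ?_⟩
    change a * α.one (𝟙 z) * r * (a * α.one (𝟙 z)) = _
    simp only [← α.one_central _ r, ← α.one_central _ a, mul_assoc]
    simp only [← mul_assoc, α.one_central]
    rw [mul_assoc (a * r * a), α.one_idem]
  choose r hr using key
  refine ⟨∑ z, r z * α.one (𝟙 z), ?_⟩
  rw [Finset.mul_sum, Finset.sum_mul, ← Finset.sum_congr rfl fun z _ => hr z, ← Finset.mul_sum,
    hsum, mul_one]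

end SkewRing

/-- Over a von Neumann regular ring, every skew groupoid ring is graded von Neumann regular: if
`a = a r a` then `α_{g⁻¹}(r 1_g) δ_{g⁻¹}` is a quasi-inverse of `a δ_g`. -/
theorem isVonNeumannRegular_grading (hA : IsVonNeumannRegular A) :
    (SkewRing.grading α).IsVonNeumannRegular := by
  rintro ⟨y, z, g⟩ _ ⟨a, rfl⟩
  obtain ⟨r, hr⟩ := hA a
  refine ⟨SkewRing.single α ⟨z, y, Groupoid.inv g⟩ ⟨α.act (Groupoid.inv g) r, α.act_mem _ r⟩, ?_⟩
  rw [SkewRing.single_comp, SkewRing.single_comp]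
  refine SkewRing.single_congr α (by simp) a.2 _ ?_
  dsimp only
  rw [α.act_act_inv_eq, Groupoid.inv_comp, α.act_id, α.mul_one_of_mem _ (α.dom_le g a.2),
    mul_assoc (a : A), mul_assoc r, α.one_mul_of_mem g a.2, ← mul_assoc]
  exact hr

/-! ### Consequences of the decomposition `A = ⨁ A_z` -/

/-- The idempotents `1_y` and `1_z` of distinct objects are orthogonal: `1_y 1_z ∈ A_y ∩ A_z = 0`. -/
theorem IsDirectSumOfObjects.one_mul_one {α : UnitalPartialAction G A}
    (hA : α.IsDirectSumOfObjects) {y z : G} (h : y ≠ z) : α.one (𝟙 y) * α.one (𝟙 z) = 0 := by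
  classical
  have h1 : α.one (𝟙 y) * α.one (𝟙 z) ∈ α.dom (𝟙 y) := α.ideal_right _ _ (α.one_mem _)
  have h2 : α.one (𝟙 y) * α.one (𝟙 z) ∈ α.dom (𝟙 z) := α.ideal_left _ _ (α.one_mem _)
  have h3 : DirectSum.of (fun z : G => α.dom (𝟙 z)) y ⟨_, h1⟩ =
      DirectSum.of (fun z : G => α.dom (𝟙 z)) z ⟨_, h2⟩ := by
    refine (show DirectSum.IsInternal fun z : G => α.dom (𝟙 z) from hA).injective ?_
    rw [DirectSum.coeAddMonoidHom_of, DirectSum.coeAddMonoidHom_of]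
  have h4 := congrArg (fun d => (d y : A)) h3
  dsimp only at h4
  rwa [DirectSum.of_eq_same, DirectSum.of_eq_of_ne _ _ _ h] at h4

theorem IsDirectSumOfObjects.sum_one [Fintype G] {α : UnitalPartialAction G A}
    (hA : α.IsDirectSumOfObjects) : ∑ z : G, α.one (𝟙 z) = 1 := by
  classical
  have key : ∀ d : DirectSum G fun z : G => α.dom (𝟙 z),
      DirectSum.coeAddMonoidHom (fun z : G => α.dom (𝟙 z)) d * ∑ z : G, α.one (𝟙 z) =
        DirectSum.coeAddMonoidHom (fun z : G => α.dom (𝟙 z)) d := by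
    intro d
    induction d using DirectSum.induction_on with
    | zero => simp
    | add c d hc hd => rw [map_add, add_mul, hc, hd]
    | of z a =>
      rw [DirectSum.coeAddMonoidHom_of, ← α.mul_one_of_mem _ a.2, mul_assoc, Finset.mul_sum,
        Finset.sum_eq_single z, α.one_idem]
      · intro y _ hy
        exact hA.one_mul_one hy.symm
      · simp
  have hA' : DirectSum.IsInternal fun z : G => α.dom (𝟙 z) := hA
  obtain ⟨d, hd⟩ := hA'.surjective 1
  have := key d
  rwa [hd, one_mul] at this

theorem mul_eq_zero_of_mem (horth : ∀ y z : G, y ≠ z → α.one (𝟙 y) * α.one (𝟙 z) = 0) {y z : G}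
    (h : y ≠ z) {a b : A} (ha : a ∈ α.dom (𝟙 y)) (hb : b ∈ α.dom (𝟙 z)) : a * b = 0 := by
  rw [← α.mul_one_of_mem _ ha, ← α.one_mul_of_mem _ hb, mul_assoc, ← mul_assoc (α.one (𝟙 y)),
    horth y z h, zero_mul, mul_zero]

/-! ### Group-type partial actions -/

section GroupType

variable {α} {x : G} {τ : ∀ y : G, x ⟶ y}

/-- `1_{h τ_y⁻¹} = 1_h` for `h ∈ G(x)`: the two idempotents are each below the other, by `act_one_comp`
applied to `(h, τ_y⁻¹)` and to `(h τ_y⁻¹, τ_y)`. -/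
theorem IsGroupType.one_inv_comp (hτ : α.IsGroupType τ) (y : G) (h : x ⟶ x) :
    α.one (Groupoid.inv (τ y) ≫ h) = α.one h := by
  have h1 := α.act_one_comp (Groupoid.inv (τ y)) h
  have h2 := α.act_one_comp (τ y) (Groupoid.inv (τ y) ≫ h)
  rw [α.one_eq_of_dom_eq (hτ.dom_inv y), α.act_one_obj] at h1
  rw [α.one_eq_of_dom_eq (hτ.dom_eq y), α.act_one_obj, ← Category.assoc, Groupoid.comp_inv,
    Category.id_comp] at h2
  rw [h2, α.one_central, ← h1]

theorem IsGroupType.one_comp (hτ : α.IsGroupType τ) {y : G} (z : G) (k : y ⟶ x) :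
    α.one (k ≫ τ z) = α.act (τ z) (α.one k) := by
  rw [α.act_one_comp, α.one_eq_of_dom_eq (hτ.dom_eq z),
    α.one_mul_of_mem _ (α.dom_le _ (α.one_mem _))]

/-- Every `g : y ⟶ z` is `τ_z h τ_y⁻¹` for a unique `h ∈ G(x)`, and then `1_g = α_{τ_z}(1_h)`; hence the
sum of the `1_g` does not depend on `y`. -/
theorem IsGroupType.sum_one_hom [∀ y z : G, Fintype (y ⟶ z)] (hτ : α.IsGroupType τ) (y z : G) :
    ∑ g : y ⟶ z, α.one g = α.act (τ z) (α.isotropyTrace x (α.one (𝟙 x))) := by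
  rw [isotropyTrace, finsum_eq_sum_of_fintype, map_sum]
  symm
  refine Fintype.sum_equiv (Iso.homCongr ((Groupoid.isoEquivHom _ _).symm (τ y))
    ((Groupoid.isoEquivHom _ _).symm (τ z))) _ _ fun h => ?_
  change _ = α.one (Groupoid.inv (τ y) ≫ h ≫ τ z)
  rw [← Category.assoc, hτ.one_comp, hτ.one_inv_comp, α.act_one_obj]

theorem IsGroupType.isUnit_sum_act [Fintype G] (hA : α.IsDirectSumOfObjects)
    (hτ : α.IsGroupType τ) {a : A} (ha : α.IsInvertibleAt x a) :
    IsUnit (∑ z : G, α.act (τ z) a) := by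
  classical
  obtain ⟨-, b, -, hab, hba⟩ := ha
  have mem : ∀ z c, α.act (τ z) c ∈ α.dom (𝟙 z) := fun z c => α.dom_le _ (α.act_mem _ _)
  have key : ∀ c d : A, c * d = α.one (𝟙 x) →
      (∑ z : G, α.act (τ z) c) * ∑ z : G, α.act (τ z) d = 1 := by
    intro c d hcd
    rw [Finset.sum_mul, ← hA.sum_one]
    refine Finset.sum_congr rfl fun z _ => ?_
    rw [Finset.mul_sum, Finset.sum_eq_single z, ← α.act_mul, hcd, α.act_one_obj,
      α.one_eq_of_dom_eq (hτ.dom_eq z)]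
    · intro w _ hw
      exact α.mul_eq_zero_of_mem (fun _ _ => hA.one_mul_one) hw.symm (mem z c) (mem w d)
    · simp
  exact ⟨⟨_, _, key a b hab, key b a hba⟩, rfl⟩

/-- Here the sum of the idempotents `1_g` over all morphisms is `|G₀| ∑_z α_{τ_z}(tr(1_x))`. -/
theorem IsGroupType.isVonNeumannRegular_skewRing [Finite G] [∀ y z : G, Finite (y ⟶ z)]
    (hA : α.IsDirectSumOfObjects) (hτ : α.IsGroupType τ) (hn : IsUnit (Nat.card G : A))
    (hreg : IsVonNeumannRegular A)
    (htr : α.IsInvertibleAt x (α.isotropyTrace x (α.one (𝟙 x)))) :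
    IsVonNeumannRegular α.SkewRing := by
  have := Fintype.ofFinite G
  have := fun y z : G => Fintype.ofFinite (y ⟶ z)
  refine SkewRing.isVonNeumannRegular_of_isUnit_sum α hreg (fun _ _ => hA.one_mul_one) ?_
  simp only [hτ.sum_one_hom, Finset.sum_const, Finset.card_univ, ← Nat.card_eq_fintype_card,
    nsmul_eq_mul]
  exact hn.mul (hτ.isUnit_sum_act hA htr)

/-- For `β` each `1_{(y,z)}` is `1_z`, so the sum of the idempotents over all morphisms is `|G₀| 1_A`. -/
theorem IsGroupType.isVonNeumannRegular_skewRing_beta [Finite G]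
    (hA : α.IsDirectSumOfObjects) (hτ : α.IsGroupType τ) (hn : IsUnit (Nat.card G : A))
    (hreg : IsVonNeumannRegular A) : IsVonNeumannRegular hτ.beta.SkewRing := by
  have := Fintype.ofFinite G
  let _ : Fintype (Codiscrete G) := Fintype.ofEquiv G codiscreteEquiv.symm
  let _ : ∀ y z : Codiscrete G, Unique (y ⟶ z) := fun _ _ => inferInstanceAs (Unique Unit)
  refine SkewRing.isVonNeumannRegular_of_isUnit_sum hτ.beta hreg
    (fun y z h => hA.one_mul_one fun e => h (Codiscrete.ext e)) ?_
  have hz : ∑ z : Codiscrete G, α.one (𝟙 z.as) = 1 :=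
    (Fintype.sum_equiv codiscreteEquiv _ (fun z => α.one (𝟙 z)) fun _ => rfl).trans hA.sum_one
  have ht : ∑ y : Codiscrete G, ∑ z : Codiscrete G, ∑ g : y ⟶ z, hτ.beta.one g =
      (Nat.card G : A) := by
    simp only [Fintype.sum_unique]
    change ∑ _y : Codiscrete G, ∑ z : Codiscrete G, α.one (𝟙 z.as) = _
    rw [hz, Finset.sum_const, Finset.card_univ, nsmul_one, Nat.card_eq_fintype_card,
      Fintype.card_congr codiscreteEquiv]
  rwa [ht]

end GroupType

end UnitalPartialAction

/-! ### Regularity of the two skew groupoid rings -/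

theorem mainTheorem1 {G : Type u} [Groupoid.{v} G] [Finite G] [∀ y z : G, Finite (y ⟶ z)]
    {A : Type w} [Ring A] (α : UnitalPartialAction G A) (hA : α.IsDirectSumOfObjects)
    {x : G} (τ : ∀ y : G, x ⟶ y) (hτ : α.IsGroupType τ) :
    (IsVonNeumannRegular A → ∀ l : hτ.beta.SkewRing,
      ∃ J : Submodule A hτ.beta.SkewRing,
        IsCompl ((Ideal.span {l}).restrictScalars A) J) ∧
    (IsUnit (Nat.card G : A) →
      [IsVonNeumannRegular A,
        (UnitalPartialAction.SkewRing.grading hτ.beta).IsVonNeumannRegular,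
        IsVonNeumannRegular hτ.beta.SkewRing,
        (UnitalPartialAction.SkewRing.grading α).IsVonNeumannRegular].TFAE ∧
      ((IsVonNeumannRegular A ∨
          (UnitalPartialAction.SkewRing.grading hτ.beta).IsVonNeumannRegular ∨
          IsVonNeumannRegular hτ.beta.SkewRing ∨
          (UnitalPartialAction.SkewRing.grading α).IsVonNeumannRegular) →
        α.IsInvertibleAt x (α.isotropyTrace x (α.one (𝟙 x))) →
        IsVonNeumannRegular α.SkewRing)) := by
  have := Fintype.ofFinite G
  let _ : Fintype (Codiscrete G) := Fintype.ofEquiv G codiscreteEquiv.symm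
  refine ⟨fun hreg l => ?_, fun hn => ?_⟩
  · have : ∀ y z : Codiscrete G, Finite (y ⟶ z) := fun _ _ => inferInstanceAs (Finite Unit)
    obtain ⟨π, h1, h2⟩ :=
      UnitalPartialAction.SkewRing.exists_projection_span_singleton hτ.beta hreg l
    let π' : hτ.beta.SkewRing →ₗ[A] (Ideal.span {l}).restrictScalars A := π.codRestrict _ h1
    exact ⟨LinearMap.ker π', LinearMap.isCompl_of_proj fun c => Subtype.ext (h2 c c.2)⟩
  · have ad := UnitalPartialAction.SkewRing.isVonNeumannRegular_of_grading α hA.sum_one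
    have hsum : ∑ z : Codiscrete G, hτ.beta.one (𝟙 z) = 1 :=
      (Fintype.sum_equiv codiscreteEquiv _ (fun z => α.one (𝟙 z)) fun _ => rfl).trans hA.sum_one
    have ba := UnitalPartialAction.SkewRing.isVonNeumannRegular_of_grading hτ.beta hsum
    have tfae : [IsVonNeumannRegular A,
        (UnitalPartialAction.SkewRing.grading hτ.beta).IsVonNeumannRegular,
        IsVonNeumannRegular hτ.beta.SkewRing,
        (UnitalPartialAction.SkewRing.grading α).IsVonNeumannRegular].TFAE := by
      tfae_have 1 → 3 := hτ.isVonNeumannRegular_skewRing_beta hA hn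
      tfae_have 3 → 2 := fun h _ a _ => h a
      tfae_have 2 → 1 := ba
      tfae_have 1 → 4 := UnitalPartialAction.isVonNeumannRegular_grading α
      tfae_have 4 → 1 := ad
      tfae_finish
    refine ⟨tfae, fun h htr => hτ.isVonNeumannRegular_skewRing hA hn ?_ htr⟩
    rcases h with h | h | h | h
    · exact h
    · exact ba h
    · exact (tfae.out 2 0).1 h
    · exact ad h
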